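/- For $n\ge 0$ let $$M_n=\sum_{k=0}^{\lfloor n/2\rfloor}\binom{n}{2k}\binom{2k}{k}\frac{1}{k+1},\qquad S_n=\sum_{k=0}^{n}\binom{n}{k}\binom{n+k}{k}\frac{1}{k+1}$$ be the $n$th Motzkin number and the $n$th (large) Schröder number, and let $\mathrm{Tr}_n$ be the $n$th central trinomial coefficient, that is, the coefficient of $x^n$ in the expansion of $(x^2+x+1)^n$. Then there exists an integer $n_0\ge 1$ such that each of the sequences $$\left(M_n^{1/n}\right)_{n\ge n_0},\qquad \left(S_n^{1/n}\right)_{n\ge n_0},\qquad \left(\mathrm{Tr}_n^{1/n}\right)_{n\ge n_0}$$ is strictly increasing, while each of the sequences $$\left(\frac{M_{n+1}^{1/(n+1)}}{M_n^{1/n}}\right)_{n\ge n_0},\qquad \left(\frac{S_{n+1}^{1/(n+1)}}{S_n^{1/n}}\right)_{n\ge n_0},\qquad \left(\frac{\mathrm{Tr}_{n+1}^{1/(n+1)}}{\mathrm{Tr}_n^{1/n}}\right)_{n\ge n_0}$$ is strictly decreasing. -/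

import Mathlib

open Polynomial

noncomputable section

/-- The `n`-th Motzkin number
`∑_{k=0}^{⌊n/2⌋} (n choose 2k) (2k choose k) / (k+1)`, as a real number. -/
def motzkinNumber (n : ℕ) : ℝ :=
  ∑ k ∈ Finset.range (n / 2 + 1),
    (n.choose (2 * k) : ℝ) * ((2 * k).choose k : ℝ) * (1 / ((k : ℝ) + 1))

/-- The `n`-th (large) Schröder number
`∑_{k=0}^{n} (n choose k) (n+k choose k) / (k+1)`, as a real number. -/
def schroderNumber (n : ℕ) : ℝ :=
  ∑ k ∈ Finset.range (n + 1),
    (n.choose k : ℝ) * ((n + k).choose k : ℝ) * (1 / ((k : ℝ) + 1))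

/-- The `n`-th central trinomial coefficient: the coefficient of `x ^ n` in the expansion of
`(x ^ 2 + x + 1) ^ n`. -/
def trinomialNumber (n : ℕ) : ℕ :=
  ((X ^ 2 + X + 1 : ℕ[X]) ^ n).coeff n

end

/-!
Let `A` be a positive sequence with `A (n + 2) = p n * A (n + 1) + q n * A n`, and let
`r n = A (n + 1) / A n`, so that `r (n + 1) = p n + q n / r n`. For the Motzkin, Schröder and
central trinomial numbers `p n` and `q n` are constants plus terms of order `1 / n`.

The map `t ↦ p₀ + q₀ / t` is a contraction near its positive fixed point `ρ`, so `r n → ρ`.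
Differencing the equation for `r` gives a perturbed linear recurrence with contraction factor
`-q₀ / ρ ^ 2` for `n ^ 2 * (r (n + 1) - r n)`, which therefore converges, and the limit is positive.
Passing to logarithms, the second difference of `x n = log (A n)` is asymptotic to `ℓ / n ^ 2` with
`ℓ > 0`.

This alone decides both claims (`eventually_div_lt_and_second_diff_lt`). Put
`y n = n * (x (n + 1) - x n) - x n`. Then `x (n + 1) / (n + 1) - x n / n = y n / (n * (n + 1))`, and
the increments of `y` are of size `ℓ / n`, so `y n → ∞`: the sequence `x n / n` increases. Its
differences decrease exactly when `n * (n + 1)` times the second difference of `x` is less than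
`2 * y n`, and there the left side is bounded. No asymptotic expansion of `A` is needed.

The recurrences of the Motzkin and Schröder numbers come from Zeilberger certificates for their
defining sums (`motzkinNumber_recurrence`, `schroderNumber_recurrence`); the recurrence of the
central trinomial coefficients comes from comparing coefficients in `P * f' = n * P' * f` for
`P = X ^ 2 + X + 1` and `f = P ^ n` (`trinomialNumber_recurrence`).
-/

open Filter Topology

/-! ### Sequences with a regular second logarithmic difference -/

theorem tendsto_zero_of_le_mul_add {e ε : ℕ → ℝ} {θ : ℝ} (he : ∀ n, 0 ≤ e n) (hθ₀ : 0 ≤ θ)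
    (hθ₁ : θ < 1) (hε : Tendsto ε atTop (𝓝 0)) (h : ∀ᶠ n in atTop, e (n + 1) ≤ θ * e n + ε n) :
    Tendsto e atTop (𝓝 0) := by
  rw [Metric.tendsto_atTop]
  intro η hη
  have hsmall : ∀ᶠ n in atTop, ε n < η / 2 * (1 - θ) :=
    hε.eventually (gt_mem_nhds (by have : 0 < 1 - θ := by linarith
                                   positivity))
  obtain ⟨N, hN⟩ := eventually_atTop.1 (h.and hsmall)
  -- Up to the additive error `η / 2`, the sequence decays geometrically from `N` on.
  have hgeom : ∀ k, e (N + k) - η / 2 ≤ θ ^ k * e N := by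
    intro k
    induction k with
    | zero => simp; linarith
    | succ k ih =>
      obtain ⟨h₁, h₂⟩ := hN (N + k) (by omega)
      have := mul_le_mul_of_nonneg_left ih hθ₀
      rw [← add_assoc, pow_succ']
      nlinarith
  have hlim : Tendsto (fun k : ℕ => θ ^ k * e N) atTop (𝓝 0) := by
    simpa using (tendsto_pow_atTop_nhds_zero_of_lt_one hθ₀ hθ₁).mul_const (e N)
  obtain ⟨K, hK⟩ := eventually_atTop.1 (hlim.eventually (gt_mem_nhds (half_pos hη)))
  refine ⟨N + K, fun n hn => ?_⟩
  obtain ⟨k, rfl⟩ := Nat.exists_eq_add_of_le (show N ≤ n by omega)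
  have h₁ := hK k (by omega)
  have h₂ := hgeom k
  rw [Real.dist_eq, sub_zero, abs_of_nonneg (he _)]
  linarith

/-- The limit is the fixed point of `t ↦ b₀ - k₀ * t`. -/
theorem tendsto_of_eq_sub_mul {z b k : ℕ → ℝ} {b₀ k₀ : ℝ} (hb : Tendsto b atTop (𝓝 b₀))
    (hk : Tendsto k atTop (𝓝 k₀)) (hk₀ : |k₀| < 1)
    (h : ∀ᶠ n in atTop, z (n + 1) = b n - k n * z n) :
    Tendsto z atTop (𝓝 (b₀ / (1 + k₀))) := by
  have hne : 1 + k₀ ≠ 0 := by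
    have := (abs_lt.1 hk₀).1
    linarith
  set l := b₀ / (1 + k₀) with hl
  have hl' : l = b₀ - k₀ * l := by
    rw [hl]; field_simp; ring
  obtain ⟨θ, hθ, hθ₁⟩ := exists_between hk₀
  have hkθ : ∀ᶠ n in atTop, |k n| < θ := hk.abs.eventually (gt_mem_nhds hθ)
  have hε : Tendsto (fun n => |b n - k n * l - l|) atTop (𝓝 0) := by
    have := ((hb.sub (hk.mul_const l)).sub_const l).abs
    rwa [← hl', sub_self, abs_zero] at this
  have hz := tendsto_zero_of_le_mul_add (e := fun n => |z n - l|) (fun n => abs_nonneg _)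
    ((abs_nonneg k₀).trans hθ.le) hθ₁ hε (by
      filter_upwards [h, hkθ] with n hn hkn
      have : z (n + 1) - l = -(k n * (z n - l)) + (b n - k n * l - l) := by rw [hn]; ring
      rw [this]
      refine (abs_add_le _ _).trans ?_
      rw [abs_neg, abs_mul]
      gcongr)
  exact tendsto_sub_nhds_zero_iff.1 ((tendsto_zero_iff_abs_tendsto_zero _).2 hz)

/-- The lower bound `m` on `r`, with `|q₀| < ρ * m`, is what makes the iteration contract towards the
fixed point `ρ` by the factor `|q₀| / (ρ * m)`. -/
theorem tendsto_of_riccati {r p q : ℕ → ℝ} {p₀ q₀ ρ m : ℝ} (hp : Tendsto p atTop (𝓝 p₀))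
    (hq : Tendsto q atTop (𝓝 q₀)) (hρ : 0 < ρ) (hfix : ρ ^ 2 = p₀ * ρ + q₀) (hm : 0 < m)
    (hqm : |q₀| < ρ * m) (hr : ∀ᶠ n in atTop, m ≤ r n)
    (h : ∀ᶠ n in atTop, r (n + 1) = p n + q n / r n) :
    Tendsto r atTop (𝓝 ρ) := by
  have hε : Tendsto (fun n => |p n - p₀| + |q n - q₀| / m) atTop (𝓝 0) := by
    have h₁ := (hp.sub_const p₀).abs
    have h₂ := (hq.sub_const q₀).abs.div_const m
    simpa using h₁.add h₂
  have hz := tendsto_zero_of_le_mul_add (e := fun n => |r n - ρ|) (fun n => abs_nonneg _)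
    (θ := |q₀| / (ρ * m)) (by positivity) ((div_lt_one (by positivity)).2 hqm) hε (by
      filter_upwards [h, hr] with n hn hrn
      have hrpos : 0 < r n := hm.trans_le hrn
      have : r (n + 1) - ρ
          = -(q₀ / (ρ * r n) * (r n - ρ)) + ((p n - p₀) + (q n - q₀) / r n) := by
        have hρ' : ρ = p₀ + q₀ / ρ := by field_simp; linarith
        rw [hn]
        nth_rewrite 1 [hρ']
        field_simp
        ring
      rw [this]
      refine (abs_add_le _ _).trans (add_le_add ?_ ((abs_add_le _ _).trans ?_))
      · rw [abs_neg, abs_mul, abs_div, abs_of_pos (mul_pos hρ hrpos)]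
        gcongr
      · rw [abs_div, abs_of_pos hrpos]
        gcongr)
  exact tendsto_sub_nhds_zero_iff.1 ((tendsto_zero_iff_abs_tendsto_zero _).2 hz)

/-- Differencing the equation for `r` gives, with `δ n = r (n + 1) - r n`,
`δ (n + 1) = (p (n + 1) - p n) + (q (n + 1) - q n) / r (n + 1) - q n / (r n * r (n + 1)) * δ n`;
multiplied by `(n + 1) ^ 2` this is a recurrence as in `tendsto_of_eq_sub_mul`. -/
theorem tendsto_sq_mul_sub_of_riccati {r p q : ℕ → ℝ} {q₀ P Q ρ : ℝ} (hq : Tendsto q atTop (𝓝 q₀))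
    (hP : Tendsto (fun n : ℕ => (n : ℝ) ^ 2 * (p (n + 1) - p n)) atTop (𝓝 P))
    (hQ : Tendsto (fun n : ℕ => (n : ℝ) ^ 2 * (q (n + 1) - q n)) atTop (𝓝 Q))
    (hρ : 0 < ρ) (hqρ : |q₀| < ρ ^ 2) (hr : Tendsto r atTop (𝓝 ρ))
    (h : ∀ᶠ n in atTop, r (n + 1) = p n + q n / r n) :
    Tendsto (fun n : ℕ => (n : ℝ) ^ 2 * (r (n + 1) - r n)) atTop
      (𝓝 ((P + Q / ρ) / (1 + q₀ / ρ ^ 2))) := by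
  have hr' : Tendsto (fun n => r (n + 1)) atTop (𝓝 ρ) := hr.comp (tendsto_add_atTop_nat 1)
  have hone : Tendsto (fun n : ℕ => ((n : ℝ) + 1) / n) atTop (𝓝 1) := by
    have : Tendsto (fun n : ℕ => 1 + 1 / (n : ℝ)) atTop (𝓝 (1 + 0)) :=
      tendsto_const_nhds.add tendsto_one_div_atTop_nhds_zero_nat
    rw [add_zero] at this
    refine this.congr' ?_
    filter_upwards [eventually_gt_atTop 0] with n hn
    have : (n : ℝ) ≠ 0 := by positivity
    field_simp
  have hsq := hone.pow 2
  have hb := hsq.mul (hP.add (hQ.div hr' hρ.ne'))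
  have hk := hsq.mul (hq.div (hr.mul hr') (by positivity))
  rw [one_pow, one_mul] at hb hk
  rw [← pow_two] at hk
  refine tendsto_of_eq_sub_mul hb hk ?_ ?_
  · rw [abs_div, abs_of_pos (by positivity : 0 < ρ ^ 2)]
    exact (div_lt_one (by positivity)).2 hqρ
  · filter_upwards [h, (tendsto_add_atTop_nat 1).eventually h, hr.eventually (lt_mem_nhds hρ),
      hr'.eventually (lt_mem_nhds hρ), eventually_gt_atTop 0] with n h₁ h₂ h₃ h₄ h₅
    have hn : (n : ℝ) ≠ 0 := by positivity
    have key : r (n + 1 + 1) - r (n + 1) = (p (n + 1) - p n) + (q (n + 1) - q n) / r (n + 1)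
        - q n / (r n * r (n + 1)) * (r (n + 1) - r n) := by
      rw [h₂]
      nth_rewrite 2 [h₁]
      field_simp
      ring
    simp only [Pi.div_apply]
    rw [key]
    push_cast
    field_simp

theorem tendsto_sq_mul_log_sub {r : ℕ → ℝ} {L ρ : ℝ} (hρ : 0 < ρ) (hr : Tendsto r atTop (𝓝 ρ))
    (hL : Tendsto (fun n : ℕ => (n : ℝ) ^ 2 * (r (n + 1) - r n)) atTop (𝓝 L)) :
    Tendsto (fun n : ℕ => (n : ℝ) ^ 2 * (Real.log (r (n + 1)) - Real.log (r n))) atTop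
      (𝓝 (L / ρ)) := by
  have hr' : Tendsto (fun n => r (n + 1)) atTop (𝓝 ρ) := hr.comp (tendsto_add_atTop_nat 1)
  refine tendsto_of_tendsto_of_tendsto_of_le_of_le' (hL.div hr' hρ.ne') (hL.div hr hρ.ne') ?_ ?_
  all_goals
    filter_upwards [hr.eventually (lt_mem_nhds hρ), hr'.eventually (lt_mem_nhds hρ)] with n h₁ h₂
    rw [Pi.div_apply, mul_div_assoc]
    refine mul_le_mul_of_nonneg_left ?_ (by positivity)
  · have := Real.log_le_sub_one_of_pos (div_pos h₁ h₂)
    rw [Real.log_div h₁.ne' h₂.ne'] at this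
    rw [sub_div, div_self h₂.ne']
    linarith
  · have := Real.log_le_sub_one_of_pos (div_pos h₂ h₁)
    rw [Real.log_div h₂.ne' h₁.ne'] at this
    rwa [sub_div, div_self h₁.ne']

/-- With `y n = n * (x (n + 1) - x n) - x n` one has
`y (n + 1) - y n = (n + 1) * (x (n + 2) - 2 * x (n + 1) + x n)`, which is asymptotic to `ℓ / n`,
so `y` diverges like the harmonic series. -/
theorem tendsto_atTop_of_tendsto_sq_mul_second_diff {x : ℕ → ℝ} {ℓ : ℝ} (hℓ : 0 < ℓ)
    (h : Tendsto (fun n : ℕ => (n : ℝ) ^ 2 * ((x (n + 2) - x (n + 1)) - (x (n + 1) - x n))) atTop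
      (𝓝 ℓ)) :
    Tendsto (fun n : ℕ => (n : ℝ) * (x (n + 1) - x n) - x n) atTop atTop := by
  set y : ℕ → ℝ := fun n => (n : ℝ) * (x (n + 1) - x n) - x n with hy
  obtain ⟨N, hN⟩ := eventually_atTop.1
    ((h.eventually (lt_mem_nhds (half_lt_self hℓ))).and (eventually_gt_atTop 0))
  set H : ℕ → ℝ := fun n => ∑ i ∈ Finset.range n, 1 / ((i : ℝ) + 1) with hH
  have hstep : ∀ k, y N + ℓ / 2 * (H (N + k) - H N) ≤ y (N + k) := by
    intro k
    induction k with
    | zero => simp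
    | succ k ih =>
      obtain ⟨h₁, h₂⟩ := hN (N + k) (by omega)
      have hHs : H (N + k + 1) = H (N + k) + 1 / (((N + k : ℕ) : ℝ) + 1) :=
        Finset.sum_range_succ _ _
      rw [← add_assoc, hHs]
      set n := N + k
      have hn : (0 : ℝ) < n := by exact_mod_cast h₂
      have hys : y (n + 1) = y n + (n + 1) * ((x (n + 2) - x (n + 1)) - (x (n + 1) - x n)) := by
        simp only [hy]; push_cast; ring
      set D := (x (n + 2) - x (n + 1)) - (x (n + 1) - x n)
      have hD : ℓ / 2 * (1 / ((n : ℝ) + 1)) ≤ (n + 1) * D := by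
        have hDpos : 0 < D := pos_of_mul_pos_right (lt_trans (by positivity) h₁) (by positivity)
        rw [mul_one_div, div_le_iff₀ (by positivity)]
        nlinarith
      rw [hys]
      linarith
  have hHlim : Tendsto H atTop atTop := Real.tendsto_sum_range_one_div_nat_succ_atTop
  have hlow : Tendsto (fun n => y N + ℓ / 2 * (H n - H N)) atTop atTop :=
    tendsto_atTop_add_const_left _ _
      ((tendsto_atTop_add_const_right _ _ hHlim).const_mul_atTop (half_pos hℓ))
  refine tendsto_atTop_mono' _ ?_ hlow
  filter_upwards [eventually_ge_atTop N] with n hn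
  obtain ⟨k, rfl⟩ := Nat.exists_eq_add_of_le hn
  exact hstep k

/-- The difference `x (n + 1) / (n + 1) - x n / n` equals `y n / (n * (n + 1))` with
`y n = n * (x (n + 1) - x n) - x n → ∞`, and it decreases as soon as
`n * (n + 1) * (x (n + 2) - 2 * x (n + 1) + x n)`, which is bounded, is less than `2 * y n`. -/
theorem eventually_div_lt_and_second_diff_lt {x : ℕ → ℝ} {ℓ : ℝ} (hℓ : 0 < ℓ)
    (h : Tendsto (fun n : ℕ => (n : ℝ) ^ 2 * ((x (n + 2) - x (n + 1)) - (x (n + 1) - x n))) atTop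
      (𝓝 ℓ)) :
    ∀ᶠ n : ℕ in atTop, x n / n < x (n + 1) / (n + 1) ∧
      x (n + 2) / (n + 2) - x (n + 1) / (n + 1) < x (n + 1) / (n + 1) - x n / n := by
  have hy := tendsto_atTop_of_tendsto_sq_mul_second_diff hℓ h
  filter_upwards [hy.eventually_gt_atTop (2 * ℓ), h.eventually (gt_mem_nhds (lt_two_mul_self hℓ)),
    h.eventually (lt_mem_nhds hℓ), eventually_ge_atTop 1] with n h₁ h₂ h₃ h₄
  have hn : (1 : ℝ) ≤ n := by exact_mod_cast h₄
  set D := (x (n + 2) - x (n + 1)) - (x (n + 1) - x n) with hD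
  set y := (n : ℝ) * (x (n + 1) - x n) - x n with hydef
  have hfirst : x (n + 1) / (n + 1) - x n / n = y / (n * (n + 1)) := by
    rw [hydef]; field_simp; ring
  have hsecond : x (n + 2) / (n + 2) - x (n + 1) / (n + 1)
      = y / (n * (n + 1)) - (2 * y - n * (n + 1) * D) / (n * (n + 1) * (n + 2)) := by
    rw [hydef, hD]; field_simp; ring
  have hDpos : 0 < D := pos_of_mul_pos_right h₃ (by positivity)
  constructor
  · have : 0 < y / (n * (n + 1)) := div_pos (by linarith) (by positivity)
    linarith
  · have : 0 < (2 * y - n * (n + 1) * D) / (n * (n + 1) * (n + 2)) := by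
      refine div_pos ?_ (by positivity)
      nlinarith [mul_nonneg (mul_nonneg (by linarith : (0 : ℝ) ≤ n) hDpos.le)
        (by linarith : (0 : ℝ) ≤ n - 1)]
    linarith

/-! ### Roots of sequences satisfying a three-term recurrence -/

theorem eventually_root_of_recurrence {A p q : ℕ → ℝ} {p₀ q₀ P Q ρ m : ℝ} (hA : ∀ n, 0 < A n)
    (hrec : ∀ n, A (n + 2) = p n * A (n + 1) + q n * A n)
    (hp : Tendsto p atTop (𝓝 p₀)) (hq : Tendsto q atTop (𝓝 q₀))
    (hP : Tendsto (fun n : ℕ => (n : ℝ) ^ 2 * (p (n + 1) - p n)) atTop (𝓝 P))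
    (hQ : Tendsto (fun n : ℕ => (n : ℝ) ^ 2 * (q (n + 1) - q n)) atTop (𝓝 Q))
    (hρ : 0 < ρ) (hfix : ρ ^ 2 = p₀ * ρ + q₀) (hm : 0 < m) (hqm : |q₀| < ρ * m)
    (hr : ∀ᶠ n in atTop, m * A n ≤ A (n + 1)) (hPQ : 0 < P + Q / ρ) :
    ∀ᶠ n : ℕ in atTop, A n ^ (1 / (n : ℝ)) < A (n + 1) ^ (1 / ((n : ℝ) + 1)) ∧
      A (n + 2) ^ (1 / ((n : ℝ) + 2)) / A (n + 1) ^ (1 / ((n : ℝ) + 1))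
        < A (n + 1) ^ (1 / ((n : ℝ) + 1)) / A n ^ (1 / (n : ℝ)) := by
  set r : ℕ → ℝ := fun n => A (n + 1) / A n with hrdef
  have hmr : ∀ᶠ n in atTop, m ≤ r n := by
    filter_upwards [hr] with n hn
    exact (le_div_iff₀ (hA n)).2 hn
  have hric : ∀ᶠ n in atTop, r (n + 1) = p n + q n / r n := by
    refine Eventually.of_forall fun n => ?_
    have h₀ := (hA n).ne'
    have h₁ := (hA (n + 1)).ne'
    simp only [hrdef]
    rw [hrec n]
    field_simp
  have hlim := tendsto_of_riccati hp hq hρ hfix hm hqm hmr hric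
  have hmρ : m ≤ ρ := ge_of_tendsto hlim hmr
  have hqρ : |q₀| < ρ ^ 2 := by nlinarith
  have hdiff := tendsto_sq_mul_log_sub hρ hlim
    (tendsto_sq_mul_sub_of_riccati hq hP hQ hρ hqρ hlim hric)
  have hpos : 0 < (P + Q / ρ) / (1 + q₀ / ρ ^ 2) / ρ := by
    have : -1 < q₀ / ρ ^ 2 := by
      rw [lt_div_iff₀ (by positivity)]
      linarith [(abs_lt.1 hqρ).1]
    exact div_pos (div_pos hPQ (by linarith)) hρ
  have hlog : ∀ n, Real.log (r n) = Real.log (A (n + 1)) - Real.log (A n) := fun n =>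
    Real.log_div (hA _).ne' (hA _).ne'
  simp only [hlog] at hdiff
  filter_upwards [eventually_div_lt_and_second_diff_lt (x := fun n => Real.log (A n)) hpos hdiff]
    with n hn
  have hexp : ∀ (k : ℕ) (t : ℝ), A k ^ (1 / t) = Real.exp (Real.log (A k) / t) := fun k t => by
    rw [Real.rpow_def_of_pos (hA k), mul_one_div]
  simp only [hexp, ← Real.exp_sub, Real.exp_lt_exp]
  exact hn

theorem tendsto_sub_div_add_const (a c d : ℝ) :
    Tendsto (fun n : ℕ => a - c / ((n : ℝ) + d)) atTop (𝓝 a) := by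
  simpa using tendsto_const_nhds.sub (tendsto_const_nhds.div_atTop
    (tendsto_atTop_add_const_right _ d tendsto_natCast_atTop_atTop))

theorem eventually_mul_le_of_linear_recurrence {A : ℕ → ℝ} {s p₀ q₀ P Q m : ℝ}
    (hA : ∀ n, 0 < A n)
    (hrec : ∀ n : ℕ, A (n + 2) = (p₀ - P / (n + s)) * A (n + 1) + (q₀ - Q / (n + s)) * A n)
    (hm : m < p₀) (hq : 0 < q₀) : ∀ᶠ n in atTop, m * A n ≤ A (n + 1) := by
  rw [← map_add_atTop_eq_nat 1, eventually_map]
  filter_upwards [(tendsto_sub_div_add_const p₀ P s).eventually (lt_mem_nhds hm),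
    (tendsto_sub_div_add_const q₀ Q s).eventually (lt_mem_nhds hq)] with n h₁ h₂
  rw [hrec n]
  have := mul_le_mul_of_nonneg_right h₁.le (hA (n + 1)).le
  have := mul_pos h₂ (hA n)
  linarith

/-- The recurrence `(n + s) * A (n + 2) = …` with coefficients linear in `n`, the situation of all
three sequences, in the partial-fraction form of its normalised coefficients. -/
theorem eventually_root_of_linear_recurrence {A : ℕ → ℝ} {s p₀ q₀ P Q ρ m : ℝ} (hs : 0 < s)
    (hA : ∀ n, 0 < A n)
    (hrec : ∀ n : ℕ, A (n + 2) = (p₀ - P / (n + s)) * A (n + 1) + (q₀ - Q / (n + s)) * A n)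
    (hρ : 0 < ρ) (hfix : ρ ^ 2 = p₀ * ρ + q₀) (hm : 0 < m) (hqm : |q₀| < ρ * m)
    (hr : ∀ᶠ n in atTop, m * A n ≤ A (n + 1)) (hPQ : 0 < P + Q / ρ) :
    ∀ᶠ n : ℕ in atTop, A n ^ (1 / (n : ℝ)) < A (n + 1) ^ (1 / ((n : ℝ) + 1)) ∧
      A (n + 2) ^ (1 / ((n : ℝ) + 2)) / A (n + 1) ^ (1 / ((n : ℝ) + 1))
        < A (n + 1) ^ (1 / ((n : ℝ) + 1)) / A n ^ (1 / (n : ℝ)) := by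
  have hquot : ∀ d : ℝ, 0 < d → Tendsto (fun n : ℕ => (n : ℝ) / (n + d)) atTop (𝓝 1) := by
    intro d hd
    refine (tendsto_sub_div_add_const 1 d d).congr fun n => ?_
    have : (n : ℝ) + d ≠ 0 := by positivity
    field_simp
    ring
  have hcoefdiff : ∀ a c : ℝ, Tendsto (fun n : ℕ => (n : ℝ) ^ 2 *
      ((a - c / (((n + 1 : ℕ) : ℝ) + s)) - (a - c / ((n : ℝ) + s)))) atTop (𝓝 c) := by
    intro a c
    have := ((hquot s hs).mul (hquot (1 + s) (by positivity))).const_mul c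
    rw [mul_one, mul_one] at this
    refine this.congr fun n => ?_
    have h₁ : (n : ℝ) + s ≠ 0 := by positivity
    have h₂ : (n : ℝ) + (1 + s) ≠ 0 := by positivity
    have h₃ : (n : ℝ) + 1 + s ≠ 0 := by positivity
    push_cast
    field_simp
    ring
  exact eventually_root_of_recurrence hA hrec (tendsto_sub_div_add_const p₀ P s)
    (tendsto_sub_div_add_const q₀ Q s) (hcoefdiff p₀ P) (hcoefdiff q₀ Q) hρ hfix hm hqm hr hPQ

theorem strictMonoOn_and_strictAntiOn_root_of_eventually {A : ℕ → ℝ}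
    (h : ∀ᶠ n : ℕ in atTop, A n ^ (1 / (n : ℝ)) < A (n + 1) ^ (1 / ((n : ℝ) + 1)) ∧
      A (n + 2) ^ (1 / ((n : ℝ) + 2)) / A (n + 1) ^ (1 / ((n : ℝ) + 1))
        < A (n + 1) ^ (1 / ((n : ℝ) + 1)) / A n ^ (1 / (n : ℝ))) :
    ∀ᶠ n₀ : ℕ in atTop, StrictMonoOn (fun n : ℕ => A n ^ (1 / (n : ℝ))) (Set.Ici n₀) ∧
      StrictAntiOn (fun n : ℕ => A (n + 1) ^ (1 / ((n : ℝ) + 1)) / A n ^ (1 / (n : ℝ)))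
        (Set.Ici n₀) := by
  filter_upwards [eventually_forall_ge_atTop.2 h] with n₀ hn₀
  constructor
  · refine strictMonoOn_of_lt_add_one Set.ordConnected_Ici fun n _ hn _ => ?_
    push_cast
    exact (hn₀ n hn).1
  · refine strictAntiOn_of_add_one_lt Set.ordConnected_Ici fun n _ hn _ => ?_
    have := (hn₀ n hn).2
    push_cast
    rwa [add_assoc (n : ℝ) 1 1, one_add_one_eq_two]

/-! ### The recurrences -/

theorem cast_choose_succ_mul (n k : ℕ) :
    (n.choose (k + 1) : ℝ) * (k + 1) = n.choose k * ((n : ℝ) - k) := by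
  rcases le_or_gt k n with h | h
  · have := Nat.choose_succ_right_eq n k
    rw [← Nat.cast_sub h]
    exact_mod_cast this
  · simp [Nat.choose_eq_zero_of_lt h, Nat.choose_eq_zero_of_lt (Nat.lt_succ_of_lt h)]

theorem cast_centralBinom_succ_div (k : ℕ) :
    ((2 * (k + 1)).choose (k + 1) : ℝ) * (1 / (((k + 1 : ℕ) : ℝ) + 1))
      = 2 * (2 * k + 1) / (k + 2) * (((2 * k).choose k : ℝ) * (1 / ((k : ℝ) + 1))) := by
  have h : ((k : ℝ) + 1) * ((2 * (k + 1)).choose (k + 1) : ℝ)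
      = 2 * (2 * k + 1) * ((2 * k).choose k : ℝ) := by
    exact_mod_cast Nat.succ_mul_centralBinom_succ k
  push_cast
  field_simp
  linear_combination (k + 2 : ℝ) * h

/-- The identity behind both Zeilberger certificates: every binomial coefficient involved is a
rational multiple of `n.choose (2 * k)`. -/
theorem cast_choose_two_mul_succ (n k : ℕ) :
    (2 * (2 * (k : ℝ) + 1)) * (k + 1) * (n.choose (2 * (k + 1)) : ℝ)
        = n.choose (2 * k) * ((n : ℝ) - 2 * k) * (n - 2 * k - 1) ∧
      (2 * (2 * (k : ℝ) + 1)) * (k + 1) * ((n + 1).choose (2 * (k + 1)) : ℝ)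
        = n.choose (2 * k) * ((n : ℝ) - 2 * k) * (n + 1) ∧
      (2 * (2 * (k : ℝ) + 1)) * (k + 1) * ((n + 2).choose (2 * (k + 1)) : ℝ)
        = n.choose (2 * k) * ((n : ℝ) + 1) * (n + 2) := by
  have h₁ := cast_choose_succ_mul n (2 * k)
  have h₂ := cast_choose_succ_mul n (2 * k + 1)
  have e₁ : ((n + 1).choose (2 * k + 2) : ℝ) = n.choose (2 * k + 1) + n.choose (2 * k + 2) := by
    exact_mod_cast Nat.choose_succ_succ n (2 * k + 1)
  have e₂ : ((n + 1).choose (2 * k + 1) : ℝ) = n.choose (2 * k) + n.choose (2 * k + 1) := by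
    exact_mod_cast Nat.choose_succ_succ n (2 * k)
  have e₃ : ((n + 2).choose (2 * k + 2) : ℝ)
      = (n + 1).choose (2 * k + 1) + (n + 1).choose (2 * k + 2) := by
    exact_mod_cast Nat.choose_succ_succ (n + 1) (2 * k + 1)
  push_cast at h₁ h₂
  rw [show 2 * (k + 1) = 2 * k + 2 by ring, e₃, e₁, e₂]
  refine ⟨?_, ?_, ?_⟩
  · linear_combination (n - 2 * k - 1 : ℝ) * h₁ + (2 * k + 1 : ℝ) * h₂
  · linear_combination (n - 2 * k - 1 + 2 * k + 2 : ℝ) * h₁ + (2 * k + 1 : ℝ) * h₂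
  · linear_combination (n - 2 * k - 1 + 2 * (2 * k + 2) : ℝ) * h₁ + (2 * k + 1 : ℝ) * h₂

/-- If `a F(n + 2, ·) + b F(n + 1, ·) + c F(n, ·)` at `k + 1` is `d F(n₁, k)`, summing over `k` gives
a recurrence for the sums of `F`. -/
theorem sum_recurrence_of_term {F : ℕ → ℕ → ℝ} {a b c d : ℝ} (n N n₁ : ℕ)
    (h₀ : a * F (n + 2) 0 + b * F (n + 1) 0 + c * F n 0 = 0)
    (h : ∀ k, a * F (n + 2) (k + 1) + b * F (n + 1) (k + 1) + c * F n (k + 1) = d * F n₁ k) :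
    a * ∑ k ∈ Finset.range (N + 1), F (n + 2) k + b * ∑ k ∈ Finset.range (N + 1), F (n + 1) k
      + c * ∑ k ∈ Finset.range (N + 1), F n k = d * ∑ k ∈ Finset.range N, F n₁ k := by
  simp only [Finset.mul_sum, ← Finset.sum_add_distrib]
  rw [Finset.sum_range_succ', h₀, add_zero]
  exact Finset.sum_congr rfl fun k _ => h k

theorem motzkinNumber_eq_sum_range (n N : ℕ) (h : n / 2 + 1 ≤ N) :
    motzkinNumber n = ∑ k ∈ Finset.range N,
      (n.choose (2 * k) : ℝ) * ((2 * k).choose k : ℝ) * (1 / ((k : ℝ) + 1)) := by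
  refine Finset.sum_subset (Finset.range_subset_range.2 h) fun k _ hk => ?_
  rw [Finset.mem_range] at hk
  rw [Nat.choose_eq_zero_of_lt (by omega)]
  simp

/-- Summation of `(n + 4) F(n + 2, k + 1) - (2 n + 5) F(n + 1, k + 1) + (n + 1) F(n, k + 1)
= 4 (n + 1) F(n, k)` for the summand `F` of the Motzkin numbers. -/
theorem motzkinNumber_recurrence (n : ℕ) :
    ((n : ℝ) + 4) * motzkinNumber (n + 2)
      = (2 * n + 5) * motzkinNumber (n + 1) + 3 * (n + 1) * motzkinNumber n := by
  have key := sum_recurrence_of_term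
    (F := fun n k => (n.choose (2 * k) : ℝ) * ((2 * k).choose k : ℝ) * (1 / ((k : ℝ) + 1)))
    (a := (n : ℝ) + 4) (b := -(2 * n + 5)) (c := n + 1) (d := 4 * (n + 1)) n (n + 3) n
    (by simp; ring) (fun k => by
      obtain ⟨h₁, h₂, h₃⟩ := cast_choose_two_mul_succ n k
      have hk : (2 * (2 * (k : ℝ) + 1)) * (k + 1) ≠ 0 := by positivity
      rw [mul_comm, ← eq_div_iff hk] at h₁ h₂ h₃
      simp only [mul_assoc, cast_centralBinom_succ_div]
      rw [h₁, h₂, h₃]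
      field_simp
      ring)
  rw [← motzkinNumber_eq_sum_range _ _ (by omega), ← motzkinNumber_eq_sum_range _ _ (by omega),
    ← motzkinNumber_eq_sum_range _ _ (by omega), ← motzkinNumber_eq_sum_range _ _ (by omega)] at key
  linear_combination key

theorem motzkinNumber_pos (n : ℕ) : 0 < motzkinNumber n := by
  refine Finset.sum_pos' (fun k _ => by positivity) ⟨0, by simp, by simp⟩

theorem schroderNumber_eq_sum_range (n N : ℕ) (h : n + 1 ≤ N) :
    schroderNumber n = ∑ k ∈ Finset.range N,
      ((n + k).choose (2 * k) : ℝ) * ((2 * k).choose k : ℝ) * (1 / ((k : ℝ) + 1)) := by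
  have hterm : ∀ k, (n.choose k : ℝ) * ((n + k).choose k : ℝ)
      = ((n + k).choose (2 * k) : ℝ) * ((2 * k).choose k : ℝ) := fun k => by
    rcases le_or_gt k n with hk | hk
    · have := Nat.choose_mul (n := n + k) (k := 2 * k) (s := k) (by omega)
      rw [show n + k - k = n by omega, show 2 * k - k = k by omega] at this
      rw [mul_comm]
      exact_mod_cast this.symm
    · simp [Nat.choose_eq_zero_of_lt hk, Nat.choose_eq_zero_of_lt (show n + k < 2 * k by omega)]
  simp only [← hterm]
  refine Finset.sum_subset (Finset.range_subset_range.2 h) fun k _ hk => ?_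
  rw [Finset.mem_range] at hk
  rw [Nat.choose_eq_zero_of_lt (by omega)]
  simp

/-- Summation of `(n + 3) F(n + 2, k + 1) - (2 n + 3) F(n + 1, k + 1) + n F(n, k + 1)
= (4 n + 6) F(n + 1, k)` for the summand `F` of the Schröder numbers. -/
theorem schroderNumber_recurrence (n : ℕ) :
    ((n : ℝ) + 3) * schroderNumber (n + 2)
      = 3 * (2 * n + 3) * schroderNumber (n + 1) - n * schroderNumber n := by
  have key := sum_recurrence_of_term
    (F := fun n k => ((n + k).choose (2 * k) : ℝ) * ((2 * k).choose k : ℝ) * (1 / ((k : ℝ) + 1)))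
    (a := (n : ℝ) + 3) (b := -(2 * n + 3)) (c := n) (d := 4 * n + 6) n (n + 3) (n + 1)
    (by simp; ring) (fun k => by
      obtain ⟨h₁, h₂, h₃⟩ := cast_choose_two_mul_succ (n + k + 1) k
      have hk : (2 * (2 * (k : ℝ) + 1)) * (k + 1) ≠ 0 := by positivity
      rw [mul_comm, ← eq_div_iff hk] at h₁ h₂ h₃
      simp only [mul_assoc, cast_centralBinom_succ_div]
      rw [show n + 2 + (k + 1) = n + k + 1 + 2 by ring, show n + 1 + (k + 1) = n + k + 1 + 1 by ring,
        show n + (k + 1) = n + k + 1 by ring, show n + 1 + k = n + k + 1 by ring, h₁, h₂, h₃]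
      push_cast
      field_simp
      ring)
  rw [← schroderNumber_eq_sum_range _ _ (by omega), ← schroderNumber_eq_sum_range _ _ (by omega),
    ← schroderNumber_eq_sum_range _ _ (by omega), ← schroderNumber_eq_sum_range _ _ (by omega)]
    at key
  linear_combination key

theorem schroderNumber_pos (n : ℕ) : 0 < schroderNumber n := by
  refine Finset.sum_pos' (fun k _ => by positivity) ⟨0, by simp, by simp⟩

theorem schroderNumber_le_succ (n : ℕ) : schroderNumber n ≤ schroderNumber (n + 1) := by
  rw [schroderNumber_eq_sum_range n (n + 2) (by omega),
    schroderNumber_eq_sum_range (n + 1) (n + 2) le_rfl]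
  refine Finset.sum_le_sum fun k _ => ?_
  have : (n + k).choose (2 * k) ≤ (n + 1 + k).choose (2 * k) := Nat.choose_le_choose _ (by omega)
  gcongr

/-- Comparison of coefficients in `(X ^ 2 + X + 1) * f' = n * (2 * X + 1) * f` for
`f = (X ^ 2 + X + 1) ^ n`. -/
theorem coeff_trinomial_pow_relation (n k : ℕ) :
    ((k : ℝ) + 2) * ((X ^ 2 + X + 1 : ℝ[X]) ^ n).coeff (k + 2)
        + (k + 1) * ((X ^ 2 + X + 1 : ℝ[X]) ^ n).coeff (k + 1)
        + k * ((X ^ 2 + X + 1 : ℝ[X]) ^ n).coeff k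
      = n * (2 * ((X ^ 2 + X + 1 : ℝ[X]) ^ n).coeff k
        + ((X ^ 2 + X + 1 : ℝ[X]) ^ n).coeff (k + 1)) := by
  set f := (X ^ 2 + X + 1 : ℝ[X]) ^ n with hf
  have h : derivative f * X ^ 2 + derivative f * X + derivative f
      = (n : ℝ[X]) * (2 * (f * X) + f) := by
    rcases n with _ | n
    · simp [hf]
    · simp only [hf, derivative_pow, derivative_add, derivative_X, derivative_one]
      simp [map_ofNat]
      ring
  have hc := congrArg (fun g => g.coeff (k + 1)) h
  rw [← C_eq_natCast, show (2 : ℝ[X]) = C 2 from rfl] at hc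
  simp only [coeff_add, coeff_C_mul, coeff_mul_X, coeff_derivative] at hc
  rcases k with _ | k
  · rw [coeff_mul_X_pow'] at hc
    simp at hc ⊢
    linarith
  · rw [show k + 1 + 1 = k + 2 from rfl, coeff_mul_X_pow, coeff_derivative] at hc
    push_cast at hc ⊢
    linarith

theorem coeff_trinomial_pow_succ (n k : ℕ) :
    ((X ^ 2 + X + 1 : ℝ[X]) ^ (n + 1)).coeff (k + 2)
      = ((X ^ 2 + X + 1 : ℝ[X]) ^ n).coeff k + ((X ^ 2 + X + 1 : ℝ[X]) ^ n).coeff (k + 1)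
        + ((X ^ 2 + X + 1 : ℝ[X]) ^ n).coeff (k + 2) := by
  rw [pow_succ, mul_add, mul_add, mul_one, coeff_add, coeff_add, coeff_mul_X_pow, coeff_mul_X]

theorem coeff_trinomial_pow_eq_cast (n k : ℕ) :
    ((X ^ 2 + X + 1 : ℝ[X]) ^ n).coeff k = (((X ^ 2 + X + 1 : ℕ[X]) ^ n).coeff k : ℝ) := by
  have : (X ^ 2 + X + 1 : ℝ[X]) ^ n = ((X ^ 2 + X + 1 : ℕ[X]) ^ n).map (Nat.castRingHom ℝ) := by
    simp
  rw [this, coeff_map]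
  rfl

theorem cast_trinomialNumber (n : ℕ) :
    (trinomialNumber n : ℝ) = ((X ^ 2 + X + 1 : ℝ[X]) ^ n).coeff n :=
  (coeff_trinomial_pow_eq_cast n n).symm

theorem trinomialNumber_succ (n : ℕ) :
    (trinomialNumber (n + 1) : ℝ)
      = trinomialNumber n + 2 * ((X ^ 2 + X + 1 : ℝ[X]) ^ n).coeff (n + 1) := by
  rw [cast_trinomialNumber, cast_trinomialNumber]
  rcases n with _ | n
  · simp [coeff_one, coeff_X]
  · -- At index `n + 1` the derivative relation says that the two neighbours of the central
    -- coefficient agree.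
    have h := coeff_trinomial_pow_relation (n + 1) n
    have hsymm : ((X ^ 2 + X + 1 : ℝ[X]) ^ (n + 1)).coeff (n + 2)
        = ((X ^ 2 + X + 1 : ℝ[X]) ^ (n + 1)).coeff n := by
      refine mul_left_cancel₀ (by positivity : (n : ℝ) + 2 ≠ 0) ?_
      push_cast at h
      linear_combination h
    rw [coeff_trinomial_pow_succ (n + 1) n, hsymm]
    ring

theorem trinomialNumber_recurrence (n : ℕ) :
    ((n : ℝ) + 2) * trinomialNumber (n + 2)
      = (2 * n + 3) * trinomialNumber (n + 1) + 3 * (n + 1) * (trinomialNumber n : ℝ) := by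
  have h₁ := trinomialNumber_succ n
  have h₂ := trinomialNumber_succ (n + 1)
  rw [coeff_trinomial_pow_succ n n] at h₂
  have h₃ := coeff_trinomial_pow_relation n n
  rw [← cast_trinomialNumber] at h₂ h₃
  linear_combination (n + 2 : ℝ) * h₂ + 2 * h₃ - (n + 1 : ℝ) * h₁

theorem cast_trinomialNumber_pos (n : ℕ) : (0 : ℝ) < trinomialNumber n := by
  induction n with
  | zero => simp [trinomialNumber]
  | succ n ih =>
    rw [trinomialNumber_succ, coeff_trinomial_pow_eq_cast]
    positivity

/-! ### The three sequences -/

/-- Here `ρ = 3` and `q₀ = 3`, so any `m` strictly between `1` and `p₀ = 2` serves as an eventual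
lower bound for the ratio of consecutive terms. -/
theorem eventually_root_motzkinNumber :
    ∀ᶠ n₀ : ℕ in atTop, StrictMonoOn (fun n : ℕ => motzkinNumber n ^ (1 / (n : ℝ))) (Set.Ici n₀) ∧
      StrictAntiOn (fun n : ℕ =>
        motzkinNumber (n + 1) ^ (1 / ((n : ℝ) + 1)) / motzkinNumber n ^ (1 / (n : ℝ)))
        (Set.Ici n₀) := by
  have hrec : ∀ n : ℕ, motzkinNumber (n + 2) = (2 - 3 / ((n : ℝ) + 4)) * motzkinNumber (n + 1)
      + (3 - 9 / ((n : ℝ) + 4)) * motzkinNumber n := fun n => by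
    field_simp
    linear_combination motzkinNumber_recurrence n
  exact strictMonoOn_and_strictAntiOn_root_of_eventually
    (eventually_root_of_linear_recurrence (ρ := 3) (m := 3 / 2) (by norm_num) motzkinNumber_pos
      hrec (by norm_num) (by norm_num) (by norm_num) (by norm_num)
      (eventually_mul_le_of_linear_recurrence motzkinNumber_pos hrec (by norm_num) (by norm_num))
      (by norm_num))

/-- Here `ρ = 3 + 2 * √2` is the larger root of `t ^ 2 = 6 * t - 1`; as `q₀ = -1` is small,
monotonicity of the sequence is a sufficient lower bound for the ratio. -/
theorem eventually_root_schroderNumber :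
    ∀ᶠ n₀ : ℕ in atTop, StrictMonoOn (fun n : ℕ => schroderNumber n ^ (1 / (n : ℝ))) (Set.Ici n₀) ∧
      StrictAntiOn (fun n : ℕ =>
        schroderNumber (n + 1) ^ (1 / ((n : ℝ) + 1)) / schroderNumber n ^ (1 / (n : ℝ)))
        (Set.Ici n₀) := by
  have hsqrt : √(2 : ℝ) ^ 2 = 2 := Real.sq_sqrt (by norm_num)
  have hpos : 0 < √(2 : ℝ) := by positivity
  have hrec : ∀ n : ℕ, schroderNumber (n + 2) = (6 - 9 / ((n : ℝ) + 3)) * schroderNumber (n + 1)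
      + (-1 - -3 / ((n : ℝ) + 3)) * schroderNumber n := fun n => by
    field_simp
    linear_combination schroderNumber_recurrence n
  refine strictMonoOn_and_strictAntiOn_root_of_eventually
    (eventually_root_of_linear_recurrence (ρ := 3 + 2 * √2) (m := 1) (by norm_num)
      schroderNumber_pos hrec (by positivity) (by linear_combination 4 * hsqrt) one_pos
      (by rw [abs_neg, abs_one]; linarith)
      (Eventually.of_forall fun n => by simpa using schroderNumber_le_succ n) ?_)
  have : -1 < -3 / (3 + 2 * √(2 : ℝ)) := by
    rw [lt_div_iff₀ (by positivity)]
    linarith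
  linarith

theorem eventually_root_trinomialNumber :
    ∀ᶠ n₀ : ℕ in atTop,
      StrictMonoOn (fun n : ℕ => (trinomialNumber n : ℝ) ^ (1 / (n : ℝ))) (Set.Ici n₀) ∧
      StrictAntiOn (fun n : ℕ =>
        (trinomialNumber (n + 1) : ℝ) ^ (1 / ((n : ℝ) + 1)) /
          (trinomialNumber n : ℝ) ^ (1 / (n : ℝ)))
        (Set.Ici n₀) := by
  have hrec : ∀ n : ℕ, (trinomialNumber (n + 2) : ℝ)
      = (2 - 1 / ((n : ℝ) + 2)) * trinomialNumber (n + 1)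
        + (3 - 3 / ((n : ℝ) + 2)) * trinomialNumber n := fun n => by
    field_simp
    linear_combination trinomialNumber_recurrence n
  exact strictMonoOn_and_strictAntiOn_root_of_eventually (A := fun n => (trinomialNumber n : ℝ))
    (eventually_root_of_linear_recurrence (ρ := 3) (m := 3 / 2) (by norm_num)
      cast_trinomialNumber_pos hrec (by norm_num) (by norm_num) (by norm_num) (by norm_num)
      (eventually_mul_le_of_linear_recurrence cast_trinomialNumber_pos hrec (by norm_num)
        (by norm_num))
      (by norm_num))

theorem theorem4 :
    ∃ n₀ : ℕ, 1 ≤ n₀ ∧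
      StrictMonoOn (fun n : ℕ => motzkinNumber n ^ (1 / (n : ℝ))) (Set.Ici n₀) ∧
      StrictMonoOn (fun n : ℕ => schroderNumber n ^ (1 / (n : ℝ))) (Set.Ici n₀) ∧
      StrictMonoOn (fun n : ℕ => (trinomialNumber n : ℝ) ^ (1 / (n : ℝ))) (Set.Ici n₀) ∧
      StrictAntiOn (fun n : ℕ =>
        motzkinNumber (n + 1) ^ (1 / ((n : ℝ) + 1)) / motzkinNumber n ^ (1 / (n : ℝ)))
        (Set.Ici n₀) ∧
      StrictAntiOn (fun n : ℕ =>
        schroderNumber (n + 1) ^ (1 / ((n : ℝ) + 1)) / schroderNumber n ^ (1 / (n : ℝ)))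
        (Set.Ici n₀) ∧
      StrictAntiOn (fun n : ℕ =>
        (trinomialNumber (n + 1) : ℝ) ^ (1 / ((n : ℝ) + 1)) /
          (trinomialNumber n : ℝ) ^ (1 / (n : ℝ)))
        (Set.Ici n₀) := by
  obtain ⟨n₀, hM, hS, hT, h₁⟩ := (eventually_root_motzkinNumber.and
    (eventually_root_schroderNumber.and
      (eventually_root_trinomialNumber.and (eventually_ge_atTop 1)))).exists
  exact ⟨n₀, h₁, hM.1, hS.1, hT.1, hM.2, hS.2, hT.2⟩
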